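/- **Proposition.** Let $H$ be a complex Hilbert space and let $\mathcal{L}(H)$ be the Banach space of bounded linear operators on $H$. Let $$\mathcal{I}(H)=\{Q\in\mathcal{L}(H): Q^2=Q,\ Q\neq 0,\ Q\neq I\}$$ carry the Banach submanifold structure induced from $\mathcal{L}(H)$. Let $\mathscr{G}(H)$ be the Grassmann manifold of all non-zero proper complemented (i.e. closed) subspaces of $H$; for $E_0,F_0\in\mathscr{G}(H)$ that are complements of each other, its chart at $E_0$ along $F_0$ is the inverse of the bijection $T\mapsto (I+T)(E_0)$ from $\mathcal{L}(E_0,F_0)$ onto the set of all complements of $F_0$. Regard both as real analytic Banach manifolds, and let $\kappa:\mathcal{I}(H)\to\mathscr{G}(H)$ be given by $\kappa(Q)=Q(H)$. Then each fiber $\kappa^{-1}(E)$ can be given a complex Banach space structure, with underlying set $\kappa^{-1}(E)$, such that 1. the zero element of $\kappa^{-1}(E)$ is the orthogonal projection $P_E$ of $H$ onto $E$; 2. the inclusion $\kappa^{-1}(E)\to\mathcal{L}(H)$ is a complex affine isometry, so that the Banach space structure is isometrically affine isomorphic to the affine-Banach space structure that the fiber has as a subset of $\mathcal{L}(H)$;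 3. with these structures, $(\mathcal{I}(H),\mathscr{G}(H),\kappa)$ is a locally trivial real analytic complex Banach bundle. Here (3) means the following. The spaces $\mathcal{I}(H)$ and $\mathscr{G}(H)$ are Hausdorff real analytic Banach manifolds, $\kappa$ is a real analytic surjection, and the norm of each fiber induces the topology that the fiber has as a subspace of $\mathcal{I}(H)$. Moreover, there are, for every $E_0\in\mathscr{G}(H)$, an open neighborhood $V_{E_0}$ of $E_0$ and a real bi-analytic bijection $\Theta_{E_0}:V_{E_0}\times\kappa^{-1}(E_0)\to\kappa^{-1}(V_{E_0})$ such that, for every $E\in V_{E_0}$, $\Theta_{E_0}(E,\cdot)$ is a complex linear map of $\kappa^{-1}(E_0)$ onto $\kappa^{-1}(E)$; and for all $E_1,E_2\in\mathscr{G}(H)$ the map $$\varphi: V_{E_1}\cap V_{E_2}\to \mathcal{L}\big(\kappa^{-1}(E_1),\kappa^{-1}(E_2)\big),\qquad \varphi(E)(x)=\Pi_2\big(\Theta_{E_2}^{-1}(\Theta_{E_1}(E,x))\big),$$ is real analytic, where $\Pi_2$ is the projection onto the second coordinate. -/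

import Mathlib

open Set Topology

universe u

noncomputable section

/-! ### Banach manifolds

The charts of one manifold may take values in different Banach spaces. -/

/-- A chart of a set `M` with values in a Banach space: a bijection from a subset `source` of `M`
onto a subset `target` of the Banach space `model`. -/
structure BanachChart (𝕜 : Type) [NontriviallyNormedField 𝕜] (M : Type u) where
  model : Type u
  [normedAddCommGroup : NormedAddCommGroup model]
  [normedSpace : NormedSpace 𝕜 model]
  [completeSpace : CompleteSpace model]
  toPartialEquiv : PartialEquiv M model

attribute [instance] BanachChart.normedAddCommGroup BanachChart.normedSpace
  BanachChart.completeSpace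

namespace BanachChart

/-- The identity chart of a Banach space. -/
def self (𝕜 : Type) [NontriviallyNormedField 𝕜] (Y : Type u) [NormedAddCommGroup Y]
    [NormedSpace 𝕜 Y] [CompleteSpace Y] : BanachChart 𝕜 Y where
  model := Y
  toPartialEquiv := PartialEquiv.refl Y

/-- The product of two charts. -/
def prod {𝕜 : Type} [NontriviallyNormedField 𝕜] {M N : Type u} (c : BanachChart 𝕜 M)
    (d : BanachChart 𝕜 N) : BanachChart 𝕜 (M × N) where
  model := c.model × d.model
  toPartialEquiv := c.toPartialEquiv.prod d.toPartialEquiv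

/-- A complex chart, seen as a real chart. -/
def toReal {M : Type u} (c : BanachChart ℂ M) : BanachChart ℝ M where
  model := c.model
  normedSpace := NormedSpace.complexToReal
  toPartialEquiv := c.toPartialEquiv

end BanachChart

/-- The atlas of a Banach space, seen as a manifold. -/
def modelAtlas (𝕜 : Type) [NontriviallyNormedField 𝕜] (Y : Type u) [NormedAddCommGroup Y]
    [NormedSpace 𝕜 Y] [CompleteSpace Y] : Set (BanachChart 𝕜 Y) :=
  {BanachChart.self 𝕜 Y}

/-- The atlas of a product manifold. -/
def prodAtlas {𝕜 : Type} [NontriviallyNormedField 𝕜] {M N : Type u}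
    (A : Set (BanachChart 𝕜 M)) (B : Set (BanachChart 𝕜 N)) : Set (BanachChart 𝕜 (M × N)) :=
  image2 BanachChart.prod A B

/-- `A` is an analytic atlas of the topological space `M`: the charts are homeomorphisms between
open sets, they cover `M`, and the changes of charts are analytic. -/
structure IsAnalyticAtlas {𝕜 : Type} [NontriviallyNormedField 𝕜] {M : Type u}
    [TopologicalSpace M] (A : Set (BanachChart 𝕜 M)) : Prop where
  isOpen_source : ∀ c ∈ A, IsOpen c.toPartialEquiv.source
  isOpen_target : ∀ c ∈ A, IsOpen c.toPartialEquiv.target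
  continuousOn : ∀ c ∈ A, ContinuousOn c.toPartialEquiv c.toPartialEquiv.source
  continuousOn_symm : ∀ c ∈ A, ContinuousOn c.toPartialEquiv.symm c.toPartialEquiv.target
  cover : ∀ x : M, ∃ c ∈ A, x ∈ c.toPartialEquiv.source
  analytic : ∀ c ∈ A, ∀ d ∈ A,
    AnalyticOnNhd 𝕜 (d.toPartialEquiv ∘ c.toPartialEquiv.symm)
      (c.toPartialEquiv.target ∩ c.toPartialEquiv.symm ⁻¹' d.toPartialEquiv.source)

/-- The map `f` between two manifolds with atlases `A` and `B` is analytic on the open set `U`: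
it is continuous there, and it is analytic in all charts. -/
structure IsAnalyticMapOn {𝕜 : Type} [NontriviallyNormedField 𝕜] {M N : Type u}
    [TopologicalSpace M] [TopologicalSpace N] (A : Set (BanachChart 𝕜 M))
    (B : Set (BanachChart 𝕜 N)) (f : M → N) (U : Set M) : Prop where
  continuousOn : ContinuousOn f U
  analytic : ∀ c ∈ A, ∀ d ∈ B,
    AnalyticOnNhd 𝕜 (d.toPartialEquiv ∘ f ∘ c.toPartialEquiv.symm)
      (c.toPartialEquiv.target ∩
        c.toPartialEquiv.symm ⁻¹' (U ∩ f ⁻¹' d.toPartialEquiv.source))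

/-- The charts of the Banach submanifold structure on a subset `S` of a Banach space `Y`: those
charts `c` of `S` that come from an analytic diffeomorphism `φ` between open subsets of `Y` which
carries the part of `S` in its domain to the part of a complemented (hence closed) subspace in its
range.
The complemented subspace is the range of a split embedding `j` of the model space of `c`.
The set `S` is a submanifold if these charts cover `S`. -/
def submanifoldAtlas (𝕜 : Type) [NontriviallyNormedField 𝕜] {Y : Type u} [NormedAddCommGroup Y]
    [NormedSpace 𝕜 Y] (S : Set Y) : Set (BanachChart 𝕜 S) :=
  {c | ∃ (φ : OpenPartialHomeomorph Y Y) (j : c.model →L[𝕜] Y),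
    AnalyticOnNhd 𝕜 φ φ.source ∧ AnalyticOnNhd 𝕜 φ.symm φ.target ∧
    Function.Injective j ∧ j.range.ClosedComplemented ∧
    (∀ y ∈ φ.source, y ∈ S ↔ φ y ∈ range j) ∧
    c.toPartialEquiv.source = Subtype.val ⁻¹' φ.source ∧
    c.toPartialEquiv.target = j ⁻¹' φ.target ∧
    ∀ s ∈ c.toPartialEquiv.source, j (c.toPartialEquiv s) = φ s}

/-! ### Analytic Banach bundles -/

/-- The fiber `κ⁻¹(ω)`, as a bare type: it carries no topology until a norm is chosen on it. -/
def Fiber {T B : Type u} (κ : T → B) (ω : B) : Type u := {x : T // κ x = ω}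

/-- The inclusion of a fiber into the total space. -/
def Fiber.val {T B : Type u} {κ : T → B} {ω : B} (x : Fiber κ ω) : T := Subtype.val x

/-- `(T, B, κ)` is a locally trivial real analytic complex Banach bundle, where `AT` and `AB` are
the real analytic atlases of `T` and `B`, and where the fibers carry the given
complex Banach space structures.

`V ω₀` is the open neighborhood of `ω₀` over which `Θ ω₀` trivializes the bundle. -/
def IsRealAnalyticComplexBanachBundle {T B : Type u} [TopologicalSpace T] [TopologicalSpace B]
    (AT : Set (BanachChart ℝ T)) (AB : Set (BanachChart ℝ B)) (κ : T → B)
    [∀ ω, NormedAddCommGroup (Fiber κ ω)] [∀ ω, NormedSpace ℂ (Fiber κ ω)]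
    [∀ ω, CompleteSpace (Fiber κ ω)] : Prop :=
  T2Space T ∧ T2Space B ∧ IsAnalyticAtlas AT ∧ IsAnalyticAtlas AB ∧
  Function.Surjective κ ∧ IsAnalyticMapOn AT AB κ univ ∧
  -- the norm of a fiber induces the topology that the fiber has as a subspace of `T`
  (∀ ω, IsInducing (Fiber.val : Fiber κ ω → T)) ∧
  ∃ (V : B → Set B) (Θ : ∀ ω₀, PartialEquiv (B × Fiber κ ω₀) T),
    (∀ ω₀, IsOpen (V ω₀) ∧ ω₀ ∈ V ω₀ ∧
      (Θ ω₀).source = V ω₀ ×ˢ univ ∧ (Θ ω₀).target = κ ⁻¹' V ω₀ ∧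
      IsAnalyticMapOn (prodAtlas AB (modelAtlas ℝ (Fiber κ ω₀))) AT (Θ ω₀) (V ω₀ ×ˢ univ) ∧
      IsAnalyticMapOn AT (prodAtlas AB (modelAtlas ℝ (Fiber κ ω₀))) (Θ ω₀).symm (κ ⁻¹' V ω₀) ∧
      ∀ ω ∈ V ω₀, ∃ L : Fiber κ ω₀ →ₗ[ℂ] Fiber κ ω,
        Function.Surjective L ∧ ∀ x, Θ ω₀ (ω, x) = (L x).val) ∧
    ∀ ω₁ ω₂, ∃ φ : B → (Fiber κ ω₁ →L[ℂ] Fiber κ ω₂),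
      (∀ ω ∈ V ω₁ ∩ V ω₂, ∀ x, φ ω x = ((Θ ω₂).symm (Θ ω₁ (ω, x))).2) ∧
      IsAnalyticMapOn AB (modelAtlas ℝ (Fiber κ ω₁ →L[ℂ] Fiber κ ω₂)) φ (V ω₁ ∩ V ω₂)

/-! ### The Grassmann manifold -/

/-- The set of all non-zero proper complemented subspaces of `X`. -/
def Grassmannian (𝕜 : Type) [NontriviallyNormedField 𝕜] (X : Type u) [NormedAddCommGroup X]
    [NormedSpace 𝕜 X] : Type u :=
  {E : Submodule 𝕜 X // E.ClosedComplemented ∧ E ≠ ⊥ ∧ E ≠ ⊤}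

namespace Grassmannian

variable {𝕜 : Type} [NontriviallyNormedField 𝕜] {X : Type u} [NormedAddCommGroup X]
  [NormedSpace 𝕜 X]

/-- The subspace of `X` that an element of the Grassmannian is. -/
def space (E : Grassmannian 𝕜 X) : Submodule 𝕜 X := E.1

theorem isClosed (E : Grassmannian 𝕜 X) : IsClosed (E.space : Set X) := E.2.1.isClosed

instance [CompleteSpace X] (E : Grassmannian 𝕜 X) : CompleteSpace E.space :=
  E.isClosed.completeSpace_coe

/-- The map `I + T : E → X`, for `T : E → F`. -/
def graphMap (E F : Grassmannian 𝕜 X) (S : E.space →L[𝕜] F.space) : E.space →L[𝕜] X :=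
  E.space.subtypeL + F.space.subtypeL ∘L S

theorem isTopCompl_graph {E F : Grassmannian 𝕜 X} (h : E.space.IsTopCompl F.space)
    (S : E.space →L[𝕜] F.space) : (graphMap E F S).range.IsTopCompl F.space := by
  have := ContinuousLinearMap.isTopCompl_range_ker_of_leftInverse (graphMap E F S)
    (E.space.projectionOntoL F.space h) (fun x => by simp [graphMap])
  rwa [Submodule.ker_projectionOntoL] at this

/-- The complemented subspace `(I + T)(E)`, for `T : E → F` and a complement `F` of `E`. -/
def graph {E F : Grassmannian 𝕜 X} (h : E.space.IsTopCompl F.space)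
    (S : E.space →L[𝕜] F.space) : Grassmannian 𝕜 X :=
  ⟨(graphMap E F S).range, (isTopCompl_graph h S).closedComplemented,
    fun h0 => F.2.2.2 <| eq_top_of_bot_isCompl <| by
      have hc := (isTopCompl_graph h S).isCompl
      rwa [h0] at hc,
    fun h0 => F.2.2.1 <| eq_bot_of_top_isCompl <| by
      have hc := (isTopCompl_graph h S).isCompl
      rwa [h0] at hc⟩

open Classical in
/-- The map that sends a complement `G` of `F` to the operator `T : E → F` with
`(I + T)(E) = G`. -/
def slope (E F G : Grassmannian 𝕜 X) : E.space →L[𝕜] F.space :=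
  if h : G.space.IsTopCompl F.space then
    -(F.space.projectionOntoL G.space h.symm ∘L E.space.subtypeL)
  else 0

theorem graph_slope {E F G : Grassmannian 𝕜 X} (h : E.space.IsTopCompl F.space)
    (hG : G.space.IsTopCompl F.space) : graph h (slope E F G) = G := by
  apply Subtype.ext
  have hle : (graphMap E F (slope E F G)).range ≤ G.space := by
    rintro _ ⟨x, rfl⟩
    have hx := Submodule.projectionL_add_projectionL_eq_self hG (x : X)
    have : graphMap E F (slope E F G) x = G.space.projectionL F.space hG x := by
      rw [← eq_sub_iff_add_eq] at hx
      rw [hx]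
      simp [graphMap, slope, hG, sub_eq_add_neg]
    exact this ▸ Submodule.projectionL_apply_mem hG _
  have hc := (isTopCompl_graph h (slope E F G)).isCompl
  exact eq_of_le_of_inf_le_of_sup_le (z := F.space) hle
    (hG.isCompl.inf_eq_bot.le.trans bot_le) (le_top.trans hc.sup_eq_top.ge)

theorem slope_graph {E F : Grassmannian 𝕜 X} (h : E.space.IsTopCompl F.space)
    (S : E.space →L[𝕜] F.space) : slope E F (graph h S) = S := by
  have hS : (graph h S).space.IsTopCompl F.space := isTopCompl_graph h S
  ext x
  have hx : (x : X) = graphMap E F S x + ((-S x : F.space) : X) := by simp [graphMap]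
  have h1 : F.space.projectionOntoL (graph h S).space hS.symm (graphMap E F S x) = 0 :=
    Submodule.projectionOntoL_apply_eq_zero_of_mem_right hS.symm ⟨x, rfl⟩
  have h2 : F.space.projectionOntoL (graph h S).space hS.symm (x : X) = -S x := by
    rw [hx, map_add, h1, zero_add, Submodule.projectionOntoL_apply_left]
  simp only [slope, hS, dite_true, neg_apply,
    ContinuousLinearMap.comp_apply, Submodule.subtypeL_apply, h2, neg_neg]

/-- For complementary subspaces `E` and `F`, the bijection from the set of all complements of `F`
onto the Banach space of all continuous operators from `E` to `F`. -/
def chart [CompleteSpace X] {E F : Grassmannian 𝕜 X} (h : E.space.IsTopCompl F.space) :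
    BanachChart 𝕜 (Grassmannian 𝕜 X) where
  model := E.space →L[𝕜] F.space
  toPartialEquiv :=
    { toFun := slope E F
      invFun := graph h
      source := {G | G.space.IsTopCompl F.space}
      target := univ
      map_source' := fun _ _ => mem_univ _
      map_target' := fun S _ => isTopCompl_graph h S
      left_inv' := fun _ hG => graph_slope h hG
      right_inv' := fun S _ => slope_graph h S }

variable (𝕜 X) in
/-- The atlas of the Grassmann manifold. -/
def atlas [CompleteSpace X] : Set (BanachChart 𝕜 (Grassmannian 𝕜 X)) :=
  {c | ∃ (E F : Grassmannian 𝕜 X) (h : E.space.IsTopCompl F.space), c = chart h}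

/-- The topology of the Grassmann manifold: a set is open if all its preimages under the
inverses of the charts are open. -/
instance : TopologicalSpace (Grassmannian 𝕜 X) :=
  ⨆ (E : Grassmannian 𝕜 X) (F : Grassmannian 𝕜 X) (h : E.space.IsTopCompl F.space),
    TopologicalSpace.coinduced (graph h) inferInstance

end Grassmannian

/-! ### The idempotents -/

/-- The set of all idempotents of `X` except `0` and `I`, with the norm topology. -/
def idempotents (𝕜 : Type) [NontriviallyNormedField 𝕜] (X : Type u) [NormedAddCommGroup X]
    [NormedSpace 𝕜 X] : Set (X →L[𝕜] X) :=
  {Q | Q ≠ 0 ∧ Q ≠ 1 ∧ IsIdempotentElem Q}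

/-- The map `κ` that sends an idempotent to its range. -/
def rangeMap {𝕜 : Type} [NontriviallyNormedField 𝕜] {X : Type u} [NormedAddCommGroup X]
    [NormedSpace 𝕜 X] (Q : idempotents 𝕜 X) : Grassmannian 𝕜 X :=
  ⟨Q.1.range, (ContinuousLinearMap.IsIdempotentElem.isTopCompl Q.2.2.2).closedComplemented,
    fun h => Q.2.1 (by
      ext x
      have : Q.1 x ∈ Q.1.range := ⟨x, rfl⟩
      rw [h] at this
      simpa using this),
    fun h => Q.2.2.1 (by
      ext x
      obtain ⟨y, rfl⟩ : x ∈ Q.1.range := h ▸ Submodule.mem_top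
      exact DFunLike.congr_fun Q.2.2.2 y)⟩

end

/-!
A subspace `E` is encoded by the orthogonal projection `P_E`, which embeds the Grassmann manifold
into the Banach space of operators; the idempotents are embedded already. Three formulas then
reduce all analyticity to that of addition, multiplication, inversion and the adjoint of operators.
The adjoint is only real linear, which is why the result is real analytic.

* The orthogonal projection onto the range of an idempotent `Q` is `Q (Q + Q* - 1)⁻¹`; this is `κ`.
* `E` and `F` are complements of each other iff `P_E - P_F` is invertible, and then the projection
  onto `E` along `F` is `P_E (P_E - P_F)⁻¹`; it determines the charts of the Grassmann manifold.
* If `u = P_F P_E + (1 - P_F) (1 - P_E)` is invertible, as it is for `F` near `E`, then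
  `u P_E = P_F u`, so `Q ↦ u Q u⁻¹` is an isomorphism from the fiber over `E`, which is the affine
  space `P_E + P_E L(H) (1 - P_E)`, to the fiber over `F`.

The idempotents form a submanifold because near an idempotent `e` they are the zeros of `L (y² - y)`
for the derivative `L z = e z + z e - z` of `y ↦ y² - y` at `e`, and `L³ = L`.
-/

open scoped Ring

/-! ### Embedded atlases -/

/-- The atlas `A` is the one induced by the map `ι` into a normed space `Y`: the charts extend to
analytic maps on open subsets of `Y`, and their inverses are analytic as maps into `Y`. All
questions of analyticity on `M` are thereby reduced to analyticity on `Y`. -/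
structure IsEmbeddedAtlas {𝕜 : Type} [NontriviallyNormedField 𝕜] {M Y : Type u}
    [TopologicalSpace M] [NormedAddCommGroup Y] [NormedSpace 𝕜 Y] (ι : M → Y)
    (A : Set (BanachChart 𝕜 M)) : Prop where
  continuous : Continuous ι
  cover : ∀ x : M, ∃ c ∈ A, x ∈ c.toPartialEquiv.source
  isOpen_target : ∀ c ∈ A, IsOpen c.toPartialEquiv.target
  continuousOn_symm : ∀ c ∈ A, ContinuousOn c.toPartialEquiv.symm c.toPartialEquiv.target
  analyticOnNhd_symm : ∀ c ∈ A,
    AnalyticOnNhd 𝕜 (ι ∘ c.toPartialEquiv.symm) c.toPartialEquiv.target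
  exists_extension : ∀ c ∈ A, ∃ (U : Set Y) (Ψ : Y → c.model), IsOpen U ∧ AnalyticOnNhd 𝕜 Ψ U ∧
    c.toPartialEquiv.source = ι ⁻¹' U ∧ ∀ x, ι x ∈ U → c.toPartialEquiv x = Ψ (ι x)

namespace IsEmbeddedAtlas

variable {𝕜 : Type} [NontriviallyNormedField 𝕜] {M N Y Z : Type u} [TopologicalSpace M]
  [TopologicalSpace N] [NormedAddCommGroup Y] [NormedSpace 𝕜 Y] [NormedAddCommGroup Z]
  [NormedSpace 𝕜 Z] {ι : M → Y} {ι' : N → Z} {A : Set (BanachChart 𝕜 M)}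
  {B : Set (BanachChart 𝕜 N)}

theorem isOpen_source (hA : IsEmbeddedAtlas ι A) {c : BanachChart 𝕜 M} (hc : c ∈ A) :
    IsOpen c.toPartialEquiv.source := by
  obtain ⟨U, -, hU, -, hs, -⟩ := hA.exists_extension c hc
  exact hs ▸ hU.preimage hA.continuous

theorem continuousOn_of_comp (hB : IsEmbeddedAtlas ι' B) {f : M → N} {V : Set M} (hV : IsOpen V)
    (hf : ContinuousOn (ι' ∘ f) V) : ContinuousOn f V := by
  intro x hx
  obtain ⟨d, hd, hxd⟩ := hB.cover (f x)
  obtain ⟨U, Ψ, hU, hΨ, hs, hdΨ⟩ := hB.exists_extension d hd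
  have hfx : ContinuousAt (ι' ∘ f) x := hf.continuousAt (hV.mem_nhds hx)
  have hxU : ι' (f x) ∈ U := by rwa [hs] at hxd
  have hΨf : ContinuousAt (fun y => Ψ ((ι' ∘ f) y)) x :=
    ContinuousAt.comp (f := ι' ∘ f) (hΨ _ hxU).continuousAt hfx
  have ht : Ψ ((ι' ∘ f) x) ∈ d.toPartialEquiv.target := by
    rw [Function.comp_apply, ← hdΨ _ hxU]
    exact d.toPartialEquiv.map_source hxd
  have hdf : ContinuousAt (fun y => d.toPartialEquiv.symm (Ψ ((ι' ∘ f) y))) x :=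
    ContinuousAt.comp (f := fun y => Ψ ((ι' ∘ f) y))
      ((hB.continuousOn_symm d hd).continuousAt ((hB.isOpen_target d hd).mem_nhds ht)) hΨf
  refine (hdf.congr ?_).continuousWithinAt
  filter_upwards [hfx.eventually_mem (hU.mem_nhds hxU)] with y hy
  rw [Function.comp_apply, ← hdΨ _ hy]
  exact d.toPartialEquiv.left_inv (by rw [hs]; exact hy)

theorem isAnalyticMapOn (hA : IsEmbeddedAtlas ι A) (hB : IsEmbeddedAtlas ι' B) {f : M → N}
    {V : Set M} (hV : IsOpen V) {G : Y → Z} {O : Set Y} (hG : AnalyticOnNhd 𝕜 G O)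
    (hVO : MapsTo ι V O) (hf : EqOn (ι' ∘ f) (G ∘ ι) V) : IsAnalyticMapOn A B f V := by
  have hcont : ContinuousOn f V := hB.continuousOn_of_comp hV
    ((hG.continuousOn.comp hA.continuous.continuousOn hVO).congr hf)
  refine ⟨hcont, fun c hc d hd => ?_⟩
  obtain ⟨U, Ψ, -, hΨ, hs, hdΨ⟩ := hB.exists_extension d hd
  have hopen : IsOpen (c.toPartialEquiv.target ∩
      c.toPartialEquiv.symm ⁻¹' (V ∩ f ⁻¹' d.toPartialEquiv.source)) :=
    (hA.continuousOn_symm c hc).isOpen_inter_preimage (hA.isOpen_target c hc)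
      (hcont.isOpen_inter_preimage hV (hB.isOpen_source hd))
  have hmem : ∀ v ∈ c.toPartialEquiv.target ∩
      c.toPartialEquiv.symm ⁻¹' (V ∩ f ⁻¹' d.toPartialEquiv.source),
      ι' (f (c.toPartialEquiv.symm v)) ∈ U := fun v hv => by
    have h := hv.2.2
    rwa [hs] at h
  have hext : AnalyticOnNhd 𝕜 (Ψ ∘ G ∘ ι ∘ c.toPartialEquiv.symm) (c.toPartialEquiv.target ∩
      c.toPartialEquiv.symm ⁻¹' (V ∩ f ⁻¹' d.toPartialEquiv.source)) := by
    refine hΨ.comp (hG.comp ((hA.analyticOnNhd_symm c hc).mono inter_subset_left)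
      fun v hv => hVO hv.2.1) fun v hv => ?_
    have h := hmem v hv
    rwa [← Function.comp_apply (f := ι') (g := f), hf hv.2.1] at h
  refine hext.congr hopen fun v hv => ?_
  simp only [Function.comp_apply]
  rw [hdΨ _ (hmem v hv), ← Function.comp_apply (f := ι') (g := f), hf hv.2.1, Function.comp_apply]

theorem isAnalyticAtlas (hA : IsEmbeddedAtlas ι A) : IsAnalyticAtlas A where
  isOpen_source _ hc := hA.isOpen_source hc
  isOpen_target := hA.isOpen_target
  continuousOn c hc := by
    obtain ⟨U, Ψ, -, hΨ, hs, hcΨ⟩ := hA.exists_extension c hc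
    rw [hs]
    exact (hΨ.continuousOn.comp hA.continuous.continuousOn fun _ h => h).congr hcΨ
  continuousOn_symm := hA.continuousOn_symm
  cover := hA.cover
  analytic c hc d hd := by
    have hid : IsAnalyticMapOn A A id univ := hA.isAnalyticMapOn hA isOpen_univ
      (analyticOnNhd_id (s := univ)) (mapsTo_univ _ _) fun _ _ => rfl
    simpa only [Function.id_comp, preimage_id, univ_inter] using hid.analytic c hc d hd

theorem prod (hA : IsEmbeddedAtlas ι A) (hB : IsEmbeddedAtlas ι' B) :
    IsEmbeddedAtlas (Prod.map ι ι') (prodAtlas A B) where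
  continuous := hA.continuous.prodMap hB.continuous
  cover x := by
    obtain ⟨c, hc, hxc⟩ := hA.cover x.1
    obtain ⟨d, hd, hxd⟩ := hB.cover x.2
    exact ⟨c.prod d, mem_image2_of_mem hc hd, hxc, hxd⟩
  isOpen_target := by
    rintro _ ⟨c, hc, d, hd, rfl⟩
    exact (hA.isOpen_target c hc).prod (hB.isOpen_target d hd)
  continuousOn_symm := by
    rintro _ ⟨c, hc, d, hd, rfl⟩
    exact (hA.continuousOn_symm c hc).prodMap (hB.continuousOn_symm d hd)
  analyticOnNhd_symm := by
    rintro _ ⟨c, hc, d, hd, rfl⟩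
    have hprod : AnalyticOnNhd 𝕜 (fun v : c.model × d.model =>
        ((ι ∘ c.toPartialEquiv.symm) v.1, (ι' ∘ d.toPartialEquiv.symm) v.2))
        (c.toPartialEquiv.target ×ˢ d.toPartialEquiv.target) := fun v hv =>
      ((hA.analyticOnNhd_symm c hc _ hv.1).fun_comp analyticAt_fst).prod
        ((hB.analyticOnNhd_symm d hd _ hv.2).fun_comp analyticAt_snd)
    exact hprod
  exists_extension := by
    rintro _ ⟨c, hc, d, hd, rfl⟩
    obtain ⟨U, Ψ, hU, hΨ, hs, hcΨ⟩ := hA.exists_extension c hc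
    obtain ⟨U', Ψ', hU', hΨ', hs', hdΨ⟩ := hB.exists_extension d hd
    refine ⟨U ×ˢ U', Prod.map Ψ Ψ', hU.prod hU', fun v hv => ?_, ?_,
      fun x hx => Prod.ext (hcΨ _ hx.1) (hdΨ _ hx.2)⟩
    · exact ((hΨ _ hv.1).fun_comp analyticAt_fst).prod ((hΨ' _ hv.2).fun_comp analyticAt_snd)
    · change c.toPartialEquiv.source ×ˢ d.toPartialEquiv.source = _
      rw [hs, hs']
      rfl

theorem modelAtlas (Y : Type u) [NormedAddCommGroup Y] [NormedSpace 𝕜 Y] [CompleteSpace Y] :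
    IsEmbeddedAtlas (id : Y → Y) (modelAtlas 𝕜 Y) where
  continuous := continuous_id
  cover x := ⟨_, mem_singleton _, mem_univ x⟩
  isOpen_target := by rintro _ rfl; exact isOpen_univ
  continuousOn_symm := by rintro _ rfl; exact continuousOn_id
  analyticOnNhd_symm := by rintro _ rfl; exact analyticOnNhd_id
  exists_extension := by
    rintro _ rfl
    exact ⟨univ, id, isOpen_univ, analyticOnNhd_id, rfl, fun _ _ => rfl⟩

theorem toReal {Y : Type u} [NormedAddCommGroup Y] [NormedSpace ℂ Y] [NormedSpace ℝ Y]
    [IsScalarTower ℝ ℂ Y] {ι : M → Y} {A : Set (BanachChart ℂ M)} (hA : IsEmbeddedAtlas ι A) :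
    IsEmbeddedAtlas ι (BanachChart.toReal '' A) where
  continuous := hA.continuous
  cover x := by
    obtain ⟨c, hc, hx⟩ := hA.cover x
    exact ⟨c.toReal, mem_image_of_mem _ hc, hx⟩
  isOpen_target := by rintro _ ⟨c, hc, rfl⟩; exact hA.isOpen_target c hc
  continuousOn_symm := by rintro _ ⟨c, hc, rfl⟩; exact hA.continuousOn_symm c hc
  analyticOnNhd_symm := by
    rintro _ ⟨c, hc, rfl⟩
    have hreal : AnalyticOnNhd ℝ (ι ∘ c.toPartialEquiv.symm) c.toPartialEquiv.target :=
      fun v hv => (hA.analyticOnNhd_symm c hc v hv).restrictScalars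
    exact hreal
  exists_extension := by
    rintro _ ⟨c, hc, rfl⟩
    obtain ⟨U, Ψ, hU, hΨ, hs, hcΨ⟩ := hA.exists_extension c hc
    have hreal : AnalyticOnNhd ℝ Ψ U := fun v hv => (hΨ v hv).restrictScalars
    exact ⟨U, Ψ, hU, hreal, hs, hcΨ⟩

end IsEmbeddedAtlas

/-! ### Submanifolds -/

section Submanifold

variable {𝕜 : Type} [NontriviallyNormedField 𝕜]

theorem exists_openPartialHomeomorph_analyticOnNhd {E F : Type*} [NormedAddCommGroup E]
    [NormedSpace 𝕜 E] [CompleteSpace E] [NormedAddCommGroup F] [NormedSpace 𝕜 F] [CompleteSpace F]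
    {f : E → F} {a : E} (hf : AnalyticAt 𝕜 f a) {f' : E ≃L[𝕜] F}
    (hf' : HasFDerivAt f (f' : E →L[𝕜] F) a) :
    ∃ φ : OpenPartialHomeomorph E F, a ∈ φ.source ∧ φ = f ∧ AnalyticOnNhd 𝕜 φ φ.source ∧
      AnalyticOnNhd 𝕜 φ.symm φ.target := by
  have hstrict : HasStrictFDerivAt f (f' : E →L[𝕜] F) a := hf'.fderiv ▸ hf.hasStrictFDerivAt
  let s : Set E := {x | AnalyticAt 𝕜 f x ∧ fderiv 𝕜 f x ∈ range ((↑) : (E ≃L[𝕜] F) → E →L[𝕜] F)}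
  have hs : s ∈ 𝓝 a := by
    refine hf.eventually_analyticAt.and (hf.fderiv.continuousAt.eventually_mem ?_)
    rw [hf'.fderiv]
    exact f'.nhds
  let φ := (hstrict.toOpenPartialHomeomorph f).restr s
  have hφs : φ.source ⊆ s := fun x hx => interior_subset hx.2
  refine ⟨φ, ⟨hstrict.mem_toOpenPartialHomeomorph_source, mem_interior_iff_mem_nhds.2 hs⟩, rfl,
    fun x hx => (hφs hx).1, fun y hy => ?_⟩
  obtain ⟨hx, i, hi⟩ := hφs (φ.map_target hy)
  exact φ.analyticAt_symm hy hx hi.symm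

variable {Y : Type u} [NormedAddCommGroup Y] [NormedSpace 𝕜 Y] [CompleteSpace Y] {S : Set Y}

theorem isEmbeddedAtlas_submanifoldAtlas
    (hS : ∀ y : S, ∃ c ∈ submanifoldAtlas 𝕜 S, y ∈ c.toPartialEquiv.source) :
    IsEmbeddedAtlas (Subtype.val : S → Y) (submanifoldAtlas 𝕜 S) := by
  have isOpen_target : ∀ c ∈ submanifoldAtlas 𝕜 S, IsOpen c.toPartialEquiv.target := by
    rintro c ⟨φ, j, -, -, -, -, -, -, ht, -⟩
    exact ht ▸ φ.open_target.preimage j.continuous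
  have analyticOnNhd_symm : ∀ c ∈ submanifoldAtlas 𝕜 S,
      AnalyticOnNhd 𝕜 (Subtype.val ∘ c.toPartialEquiv.symm) c.toPartialEquiv.target := by
    intro c hc
    obtain ⟨φ, j, -, hφ', -, -, -, hs, ht, hjφ⟩ := id hc
    have hcomp : AnalyticOnNhd 𝕜 (φ.symm ∘ j) c.toPartialEquiv.target :=
      hφ'.comp (j.analyticOnNhd _) fun v hv => by rwa [ht] at hv
    refine hcomp.congr (isOpen_target c hc) fun v hv => ?_
    have hsource := c.toPartialEquiv.map_target hv
    have hj := hjφ _ hsource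
    rw [c.toPartialEquiv.right_inv hv] at hj
    rw [Function.comp_apply, Function.comp_apply, hj, φ.left_inv]
    rwa [hs] at hsource
  refine ⟨continuous_subtype_val, hS, isOpen_target, fun c hc =>
    IsInducing.subtypeVal.continuousOn_iff.2 (analyticOnNhd_symm c hc).continuousOn,
    analyticOnNhd_symm, ?_⟩
  rintro c ⟨φ, j, hφ, -, hj, hjc, -, hs, -, hjφ⟩
  have hl : j.HasLeftInverse :=
    ContinuousLinearMap.HasLeftInverse.of_injective_of_isClosed_range_of_closedComplement_range
      hj hjc.isClosed hjc
  refine ⟨φ.source, hl.leftInverse ∘ φ, φ.open_source,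
    (hl.leftInverse.analyticOnNhd univ).comp hφ (mapsTo_univ _ _), hs, fun x hx => ?_⟩
  rw [Function.comp_apply, ← hjφ x (by rw [hs]; exact hx), hl.leftInverse_leftInverse]

theorem exists_mem_submanifoldAtlas_of_straightening (φ : OpenPartialHomeomorph Y Y)
    (hφ : AnalyticOnNhd 𝕜 φ φ.source) (hφ' : AnalyticOnNhd 𝕜 φ.symm φ.target) {p : Y →L[𝕜] Y}
    (hp : IsIdempotentElem p) (hS : ∀ y ∈ φ.source, y ∈ S ↔ φ y ∈ p.range) {y : S}
    (hy : (y : Y) ∈ φ.source) : ∃ c ∈ submanifoldAtlas 𝕜 S, y ∈ c.toPartialEquiv.source := by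
  classical
  have hpc : p.range.ClosedComplemented :=
    (ContinuousLinearMap.IsIdempotentElem.isTopCompl hp).closedComplemented
  have : CompleteSpace p.range := hpc.isClosed.completeSpace_coe
  have hpp : ∀ v ∈ p.range, p v = v := by
    rintro _ ⟨w, rfl⟩
    exact DFunLike.congr_fun hp w
  have hpφ : ∀ s : S, (s : Y) ∈ φ.source → p (φ s) = φ s := fun s hs => hpp _ ((hS s hs).1 s.2)
  have hmem : ∀ v : p.range, (v : Y) ∈ φ.target → φ.symm v ∈ S := fun v hv =>
    (hS _ (φ.map_target hv)).2 (by rw [φ.right_inv hv]; exact v.2)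
  let c : BanachChart 𝕜 S :=
    { model := p.range
      toPartialEquiv :=
        { toFun := fun s => ⟨p (φ s), LinearMap.mem_range_self _ _⟩
          invFun := fun v => if h : (v : Y) ∈ φ.target then ⟨φ.symm v, hmem v h⟩ else y
          source := Subtype.val ⁻¹' φ.source
          target := p.range.subtypeL ⁻¹' φ.target
          map_source' := fun s hs =>
            show p (φ s) ∈ φ.target from (hpφ s hs).symm ▸ φ.map_source hs
          map_target' := fun v (hv : (v : Y) ∈ φ.target) => by
            simp only [hv, dite_true]
            exact φ.map_target hv
          left_inv' := fun s hs => by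
            have htarget : φ s ∈ φ.target := φ.map_source hs
            simp only [hpφ s hs, htarget, dite_true, φ.left_inv (mem_preimage.1 hs)]
          right_inv' := fun v (hv : (v : Y) ∈ φ.target) => Subtype.ext <| by
            simp only [hv, dite_true, φ.right_inv hv, hpp _ v.2] } }
  refine ⟨c, ⟨φ, p.range.subtypeL, hφ, hφ', Subtype.val_injective, ?_, ?_, rfl, rfl, hpφ⟩, hy⟩
  · exact (Submodule.range_subtype p.range).symm ▸ hpc
  · intro z hz
    rw [hS z hz]
    exact ⟨fun h => ⟨⟨_, h⟩, rfl⟩, fun ⟨v, hv⟩ => hv ▸ v.2⟩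

theorem exists_mem_submanifoldAtlas_of_hasFDerivAt {Z : Type*} [NormedAddCommGroup Z]
    [NormedSpace 𝕜 Z] {y : S} {F : Y → Z} (hF : AnalyticAt 𝕜 F y) {L : Y →L[𝕜] Z}
    (hL : HasFDerivAt F L y) {K : Z →L[𝕜] Y} (hK : K ∘L L ∘L K = K)
    (hS : ∀ᶠ x in 𝓝 (y : Y), x ∈ S ↔ K (F x) = 0) :
    ∃ c ∈ submanifoldAtlas 𝕜 S, y ∈ c.toPartialEquiv.source := by
  have hKLK : ∀ z, K (L (K z)) = K z := DFunLike.congr_fun hK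
  let p : Y →L[𝕜] Y := 1 - K ∘L L
  have hp : IsIdempotentElem p := by
    have hKL : IsIdempotentElem (K ∘L L) := ContinuousLinearMap.ext fun x => hKLK (L x)
    exact hKL.one_sub
  have hmem : ∀ x, p x + K (F x) ∈ p.range ↔ K (F x) = 0 := fun x => by
    rw [LinearMap.IsIdempotentElem.mem_range_iff
      (ContinuousLinearMap.isIdempotentElem_toLinearMap_iff.2 hp)]
    simp [p, hKLK]
  obtain ⟨φ, hyφ, hφ_eq, hφ, hφ'⟩ := exists_openPartialHomeomorph_analyticOnNhd
    (f := fun x => p x + K (F x)) (f' := ContinuousLinearEquiv.refl 𝕜 Y)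
    ((p.analyticAt y).add ((K.analyticAt _).comp hF))
    ((p.hasFDerivAt.add (K.hasFDerivAt.comp (y : Y) hL)).congr_fderiv (by ext x; simp [p]))
  obtain ⟨U, hUS, hU, hyU⟩ := eventually_nhds_iff.1 hS
  refine exists_mem_submanifoldAtlas_of_straightening (φ.restrOpen U hU)
    (hφ.mono inter_subset_left) (hφ'.mono inter_subset_left) hp (fun x hx => ?_) ⟨hyφ, hyU⟩
  rw [hUS x hx.2, ← hmem x]
  exact iff_of_eq (congrArg (· ∈ p.range) (congrFun hφ_eq x).symm)

end Submanifold

/-! ### The submanifold of idempotents -/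

section Idempotents

theorem eventually_isIdempotentElem_iff {R : Type*} [NormedRing R] {e : R}
    (he : IsIdempotentElem e) :
    ∀ᶠ y in 𝓝 e, IsIdempotentElem y ↔ e * (y * y - y) + (y * y - y) * e - (y * y - y) = 0 := by
  have hnear : ∀ᶠ y in 𝓝 e, ‖2 * e - 1‖ * (2 * ‖e - y‖) < 1 := by
    have hcont : Continuous fun y => ‖2 * e - 1‖ * (2 * ‖e - y‖) := by fun_prop
    exact hcont.continuousAt.eventually_lt_const (by simp)
  filter_upwards [hnear] with y hy
  refine ⟨fun h => by simp [h.eq], fun h => ?_⟩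
  set z := y * y - y with hz
  -- `z` commutes with `y`, and `e` is close to `y`; but `z = e z + z e` makes `z` far from
  -- commuting with `e` unless it vanishes.
  have hcomm : (2 * e - 1) * z = (e - y) * z - z * (e - y) := by
    have hyz : y * z = z * y := by rw [hz]; noncomm_ring
    have hsub : (2 * e - 1) * z - ((e - y) * z - z * (e - y)) =
        (e * z + z * e - z) + (y * z - z * y) := by noncomm_ring
    rwa [h, hyz, sub_self, add_zero, sub_eq_zero] at hsub
  have hinvol : z = (2 * e - 1) * ((2 * e - 1) * z) := by
    have h4 : (2 * e - 1) * (2 * e - 1) = 4 * (e * e) - 4 * e + 1 := by noncomm_ring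
    rw [← mul_assoc, h4, he.eq, sub_self, zero_add, one_mul]
  have hle : ‖z‖ ≤ ‖2 * e - 1‖ * (2 * ‖e - y‖) * ‖z‖ := calc
    ‖z‖ = ‖(2 * e - 1) * ((e - y) * z - z * (e - y))‖ := by rw [← hcomm, ← hinvol]
    _ ≤ ‖2 * e - 1‖ * (‖e - y‖ * ‖z‖ + ‖z‖ * ‖e - y‖) := by
      refine (norm_mul_le _ _).trans ?_
      gcongr
      exact (norm_sub_le _ _).trans (add_le_add (norm_mul_le _ _) (norm_mul_le _ _))
    _ = ‖2 * e - 1‖ * (2 * ‖e - y‖) * ‖z‖ := by ring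
  have hz0 : z = 0 := by
    rw [← norm_le_zero_iff]
    nlinarith [norm_nonneg z]
  exact sub_eq_zero.1 hz0

variable {𝕜 : Type} [NontriviallyNormedField 𝕜]

theorem exists_mem_submanifoldAtlas_idempotents {X : Type u} [NormedAddCommGroup X]
    [NormedSpace 𝕜 X] [CompleteSpace X] (Q : idempotents 𝕜 X) :
    ∃ c ∈ submanifoldAtlas 𝕜 (idempotents 𝕜 X), Q ∈ c.toPartialEquiv.source := by
  obtain ⟨e, h0, h1, he⟩ := Q
  let L : (X →L[𝕜] X) →L[𝕜] (X →L[𝕜] X) :=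
    ContinuousLinearMap.mul 𝕜 _ e + (ContinuousLinearMap.mul 𝕜 _).flip e - 1
  have hL : HasFDerivAt (fun y => y * y - y) L e :=
    (((hasFDerivAt_id e).mul' (hasFDerivAt_id e)).sub (hasFDerivAt_id e)).congr_fderiv <| by
      ext1 z
      simp [L]
  have hL3 : L ∘L L ∘L L = L := by
    have h (z : X →L[𝕜] X) : e * (e * z) = e * z := by rw [← mul_assoc, he.eq]
    ext1 z
    simp only [L, ContinuousLinearMap.comp_apply, sub_apply, add_apply, mul_add, add_mul, mul_sub,
      sub_mul, ContinuousLinearMap.flip_apply, ContinuousLinearMap.mul_apply', mul_assoc, he.eq, h,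
      one_apply_eq_self]
    abel
  refine exists_mem_submanifoldAtlas_of_hasFDerivAt (F := fun y => y * y - y) (by fun_prop)
    hL hL3 ?_
  filter_upwards [eventually_isIdempotentElem_iff he, isOpen_ne.mem_nhds h0,
    isOpen_ne.mem_nhds h1] with y hy hy0 hy1
  exact ⟨fun h => hy.1 h.2.2, fun h => ⟨hy0, hy1, hy.2 h⟩⟩

theorem isEmbeddedAtlas_idempotents (𝕜 : Type) [NontriviallyNormedField 𝕜] (X : Type u)
    [NormedAddCommGroup X] [NormedSpace 𝕜 X] [CompleteSpace X] :
    IsEmbeddedAtlas (Subtype.val : idempotents 𝕜 X → X →L[𝕜] X)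
      (submanifoldAtlas 𝕜 (idempotents 𝕜 X)) :=
  isEmbeddedAtlas_submanifoldAtlas exists_mem_submanifoldAtlas_idempotents

end Idempotents

/-! ### Orthogonal and oblique projections -/

/-- For an idempotent operator `Q` on a Hilbert space, this is the orthogonal projection onto the
range of `Q`. -/
noncomputable def orthogonalize {R : Type*} [Ring R] [Star R] (Q : R) : R := Q * (Q + star Q - 1)⁻¹ʳ

section Analytic

variable {R : Type*} [NormedRing R]

theorem analyticAt_ringInverse_comp {𝕜 Z : Type*} [NontriviallyNormedField 𝕜] [NormedAlgebra 𝕜 R]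
    [CompleteSpace R] [NormedAddCommGroup Z] [NormedSpace 𝕜 Z] {f : Z → R} {z : Z}
    (hf : AnalyticAt 𝕜 f z) (hz : IsUnit (f z)) : AnalyticAt 𝕜 (fun z => (f z)⁻¹ʳ) z :=
  AnalyticAt.fun_comp (g := Ring.inverse) (analyticOnNhd_inverse _ hz) hf

theorem analyticOnNhd_orthogonalize [NormedAlgebra ℝ R] [CompleteSpace R] [StarRing R]
    [StarModule ℝ R] [ContinuousStar R] :
    AnalyticOnNhd ℝ orthogonalize {Q : R | IsUnit (Q + star Q - 1)} := fun Q hQ => by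
  have hstar : AnalyticAt ℝ (star : R → R) Q := (starL' ℝ : R ≃L[ℝ] R).analyticAt Q
  exact analyticAt_id.mul
    (analyticAt_ringInverse_comp ((analyticAt_id.add hstar).sub analyticAt_const) hQ)

end Analytic

section Projections

variable {𝕜 : Type*} [RCLike 𝕜] {H : Type*} [NormedAddCommGroup H] [InnerProductSpace 𝕜 H]
  {E F : Submodule 𝕜 H}

theorem starProjection_mul_of_forall_mem [E.HasOrthogonalProjection] {A : H →L[𝕜] H}
    (hA : ∀ x, A x ∈ E) : E.starProjection * A = A :=
  ContinuousLinearMap.ext fun x => Submodule.starProjection_eq_self_iff.2 (hA x)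

theorem mul_starProjection_of_forall_mem [E.HasOrthogonalProjection] {A B : H →L[𝕜] H}
    (hAB : ∀ x ∈ E, A x = B x) : A * E.starProjection = B * E.starProjection :=
  ContinuousLinearMap.ext fun x => hAB _ (E.starProjection_apply_mem x)

theorem projectionL_mul_starProjection_left [E.HasOrthogonalProjection] (h : E.IsTopCompl F) :
    E.projectionL F h * E.starProjection = E.starProjection := by
  rw [mul_starProjection_of_forall_mem (B := 1) fun x hx =>
    Submodule.projectionL_apply_left h ⟨x, hx⟩, one_mul]

theorem projectionL_mul_starProjection_right [F.HasOrthogonalProjection] (h : E.IsTopCompl F) :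
    E.projectionL F h * F.starProjection = 0 := by
  rw [mul_starProjection_of_forall_mem (B := 0) fun x hx =>
    Submodule.projectionL_apply_right h ⟨x, hx⟩, zero_mul]

theorem starProjection_left_mul_projectionL [E.HasOrthogonalProjection] (h : E.IsTopCompl F) :
    E.starProjection * E.projectionL F h = E.projectionL F h :=
  starProjection_mul_of_forall_mem (Submodule.projectionL_apply_mem h)

theorem starProjection_right_mul_projectionL [F.HasOrthogonalProjection] (h : E.IsTopCompl F) :
    F.starProjection * E.projectionL F h = F.starProjection - 1 + E.projectionL F h := by
  have hF : F.starProjection * (1 - E.projectionL F h) = 1 - E.projectionL F h :=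
    starProjection_mul_of_forall_mem fun x => by
      rw [sub_apply, one_apply_eq_self, ← Submodule.projectionL_eq_self_sub_projectionL h]
      exact Submodule.projectionL_apply_mem h.symm x
  rw [mul_sub, mul_one] at hF
  linear_combination (norm := abel) -hF

theorem isCompl_of_isUnit_starProjection_sub [E.HasOrthogonalProjection]
    [F.HasOrthogonalProjection] (hu : IsUnit (E.starProjection - F.starProjection)) :
    IsCompl E F := by
  refine ⟨Submodule.disjoint_def.2 fun x hxE hxF => ?_, codisjoint_iff_le_sup.2 fun x _ => ?_⟩
  · have hx : (E.starProjection - F.starProjection) x = 0 := by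
      rw [sub_apply, Submodule.starProjection_eq_self_iff.2 hxE,
        Submodule.starProjection_eq_self_iff.2 hxF, sub_self]
    have hinv := DFunLike.congr_fun (Ring.inverse_mul_cancel _ hu) x
    rw [mul_apply_eq_comp, hx, map_zero] at hinv
    exact hinv.symm
  · have hinv := DFunLike.congr_fun (Ring.mul_inverse_cancel _ hu) x
    rw [one_apply_eq_self, mul_apply_eq_comp, sub_apply, sub_eq_add_neg] at hinv
    rw [← hinv]
    exact Submodule.add_mem_sup (E.starProjection_apply_mem _)
      (F.neg_mem (F.starProjection_apply_mem _))

variable [CompleteSpace H]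

theorem starProjection_mul_star_projectionL [E.HasOrthogonalProjection] (h : E.IsTopCompl F) :
    E.starProjection * star (E.projectionL F h) = E.starProjection := by
  simpa only [star_mul, (isSelfAdjoint_starProjection _).star_eq] using
    congrArg star (projectionL_mul_starProjection_left h)

theorem starProjection_right_mul_star_projectionL [F.HasOrthogonalProjection]
    (h : E.IsTopCompl F) : F.starProjection * star (E.projectionL F h) = 0 := by
  simpa only [star_mul, star_zero, (isSelfAdjoint_starProjection _).star_eq] using
    congrArg star (projectionL_mul_starProjection_right h)

variable [E.HasOrthogonalProjection] [F.HasOrthogonalProjection]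

theorem starProjection_sub_mul_projectionL_add_star_sub_one (h : E.IsTopCompl F) :
    (E.starProjection - F.starProjection) *
      (E.projectionL F h + star (E.projectionL F h) - 1) = 1 := by
  rw [sub_mul, mul_sub, mul_sub, mul_add, mul_add, starProjection_mul_star_projectionL,
    starProjection_right_mul_star_projectionL, starProjection_left_mul_projectionL,
    starProjection_right_mul_projectionL, mul_one, mul_one]
  abel

theorem projectionL_add_star_sub_one_mul_starProjection_sub (h : E.IsTopCompl F) :
    (E.projectionL F h + star (E.projectionL F h) - 1) *
      (E.starProjection - F.starProjection) = 1 := by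
  simpa only [star_mul, star_sub, star_add, star_star, star_one, add_comm,
    (isSelfAdjoint_starProjection _).star_eq] using
    congrArg star (starProjection_sub_mul_projectionL_add_star_sub_one h)

theorem isUnit_starProjection_sub (h : E.IsTopCompl F) :
    IsUnit (E.starProjection - F.starProjection) :=
  ⟨⟨_, _, starProjection_sub_mul_projectionL_add_star_sub_one h,
    projectionL_add_star_sub_one_mul_starProjection_sub h⟩, rfl⟩

theorem isUnit_projectionL_add_star_sub_one (h : E.IsTopCompl F) :
    IsUnit (E.projectionL F h + star (E.projectionL F h) - 1) :=
  ⟨⟨_, _, projectionL_add_star_sub_one_mul_starProjection_sub h,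
    starProjection_sub_mul_projectionL_add_star_sub_one h⟩, rfl⟩

theorem projectionL_eq_mul_inverse (h : E.IsTopCompl F) :
    E.projectionL F h = E.starProjection * (E.starProjection - F.starProjection)⁻¹ʳ := by
  rw [Ring.eq_mul_inverse_iff_mul_eq _ _ _ (isUnit_starProjection_sub h), mul_sub,
    projectionL_mul_starProjection_left, projectionL_mul_starProjection_right, sub_zero]

theorem orthogonalize_projectionL (h : E.IsTopCompl F) :
    orthogonalize (E.projectionL F h) = E.starProjection := by
  rw [orthogonalize, eq_comm,
    Ring.eq_mul_inverse_iff_mul_eq _ _ _ (isUnit_projectionL_add_star_sub_one h), mul_sub, mul_add,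
    starProjection_mul_star_projectionL, starProjection_left_mul_projectionL, mul_one,
    add_sub_cancel_right]

theorem isTopCompl_iff_isUnit_starProjection_sub :
    E.IsTopCompl F ↔ IsUnit (E.starProjection - F.starProjection) :=
  ⟨isUnit_starProjection_sub, fun hu => Submodule.isTopCompl_iff_isCompl_isClosed.2
    ⟨isCompl_of_isUnit_starProjection_sub hu, (Submodule.isTopCompl_orthogonal (K := E)).isClosed,
      (Submodule.isTopCompl_orthogonal (K := F)).isClosed⟩⟩

theorem isUnit_add_star_sub_one {Q : H →L[𝕜] H} (hQ : IsIdempotentElem Q) :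
    IsUnit (Q + star Q - 1) := by
  have := ContinuousLinearMap.IsIdempotentElem.hasOrthogonalProjection_range hQ
  have := (ContinuousLinearMap.isClosed_ker Q).completeSpace_coe
  have h := isUnit_projectionL_add_star_sub_one
    (ContinuousLinearMap.IsIdempotentElem.isTopCompl hQ)
  rwa [← ContinuousLinearMap.IsIdempotentElem.eq_projectionL hQ] at h

theorem orthogonalize_eq_starProjection_range {Q : H →L[𝕜] H} (hQ : IsIdempotentElem Q)
    [Q.range.HasOrthogonalProjection] : orthogonalize Q = Q.range.starProjection := by
  have := (ContinuousLinearMap.isClosed_ker Q).completeSpace_coe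
  have h := orthogonalize_projectionL (ContinuousLinearMap.IsIdempotentElem.isTopCompl hQ)
  rwa [← ContinuousLinearMap.IsIdempotentElem.eq_projectionL hQ] at h

end Projections

/-! ### The Grassmann manifold as an embedded manifold -/

namespace Grassmannian

section General

variable {𝕜 : Type} [NontriviallyNormedField 𝕜] {X : Type u} [NormedAddCommGroup X]
  [NormedSpace 𝕜 X] {E F G : Grassmannian 𝕜 X}

theorem continuous_graph (h : E.space.IsTopCompl F.space) : Continuous (graph h) :=
  continuous_iff_coinduced_le.2 (le_iSup_of_le E (le_iSup_of_le F (le_iSup_of_le h le_rfl)))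

theorem projectionL_graph (h : E.space.IsTopCompl F.space) (S : E.space →L[𝕜] F.space) :
    (graph h S).space.projectionL F.space (isTopCompl_graph h S) =
      graphMap E F S ∘L E.space.projectionOntoL F.space h := by
  have hS : (graph h S).space.IsTopCompl F.space := isTopCompl_graph h S
  ext x
  obtain ⟨e, he⟩ : (graph h S).space.projectionL F.space hS x ∈ (graph h S).space :=
    Submodule.projectionL_apply_mem hS x
  have hf := Submodule.projectionL_apply_mem hS.symm x
  have hx : x = graphMap E F S e + F.space.projectionL (graph h S).space hS.symm x :=
    (Submodule.projectionL_add_projectionL_eq_self hS x).symm.trans (congrArg (· + _) he.symm)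
  have hex : E.space.projectionOntoL F.space h x = e := by
    rw [hx, map_add, Submodule.projectionOntoL_apply_eq_zero_of_mem_right h hf]
    simp [graphMap]
  rw [ContinuousLinearMap.comp_apply, hex]
  exact he.symm

theorem analyticOnNhd_projectionL_graph (h : E.space.IsTopCompl F.space) :
    AnalyticOnNhd 𝕜 (fun S => (graph h S).space.projectionL F.space (isTopCompl_graph h S))
      univ := by
  let π := E.space.projectionOntoL F.space h
  have haffine : ∀ S, (graph h S).space.projectionL F.space (isTopCompl_graph h S) =
      E.space.subtypeL ∘L π +
        (ContinuousLinearMap.compL 𝕜 X F.space X F.space.subtypeL ∘L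
          (ContinuousLinearMap.compL 𝕜 X E.space F.space).flip π) S := fun S => by
    rw [projectionL_graph]
    ext x
    simp [graphMap, π]
  simp only [haffine]
  exact fun S _ => analyticAt_const.add (ContinuousLinearMap.analyticAt _ _)

theorem slope_eq (h : E.space.IsTopCompl F.space) (hG : G.space.IsTopCompl F.space) :
    slope E F G = F.space.projectionOntoL E.space h.symm ∘L
      G.space.projectionL F.space hG ∘L E.space.subtypeL := by
  ext x
  have hx := congrArg (F.space.projectionOntoL E.space h.symm)
    (Submodule.projectionL_add_projectionL_eq_self hG (x : X))
  have hF : F.space.projectionOntoL E.space h.symm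
      (F.space.projectionL G.space hG.symm (x : X)) =
      F.space.projectionOntoL G.space hG.symm (x : X) := by
    rw [← Submodule.coe_projectionOntoL_apply, Submodule.projectionOntoL_apply_left]
  rw [map_add, hF, Submodule.projectionOntoL_apply_right] at hx
  simp only [slope, hG, dite_true, neg_apply, ContinuousLinearMap.comp_apply,
    Submodule.subtypeL_apply, eq_neg_of_add_eq_zero_left hx]

end General

section Hilbert

variable {𝕜 : Type} [RCLike 𝕜] {H : Type u} [NormedAddCommGroup H] [InnerProductSpace 𝕜 H]
  [CompleteSpace H]

/-- The orthogonal projection onto an element of the Grassmannian. It embeds the Grassmannian into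
the space of operators. -/
noncomputable def proj (E : Grassmannian 𝕜 H) : H →L[𝕜] H := E.space.starProjection

theorem isIdempotentElem_proj (E : Grassmannian 𝕜 H) : IsIdempotentElem (proj E) :=
  Submodule.isIdempotentElem_starProjection E.space

theorem mem_space_iff {E : Grassmannian 𝕜 H} {x : H} : x ∈ E.space ↔ proj E x = x :=
  Submodule.starProjection_eq_self_iff.symm

theorem proj_injective : Function.Injective (proj : Grassmannian 𝕜 H → H →L[𝕜] H) :=
  fun E F h => Subtype.ext (Submodule.starProjection_inj (U := E.space) (V := F.space).1 h)

theorem proj_rangeMap (Q : idempotents 𝕜 H) : proj (rangeMap Q) = orthogonalize Q.1 :=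
  have : Q.1.range.HasOrthogonalProjection :=
    ContinuousLinearMap.IsIdempotentElem.hasOrthogonalProjection_range Q.2.2.2
  (orthogonalize_eq_starProjection_range Q.2.2.2).symm

theorem isTopCompl_iff {E F : Grassmannian 𝕜 H} :
    E.space.IsTopCompl F.space ↔ IsUnit (proj E - proj F) :=
  isTopCompl_iff_isUnit_starProjection_sub

theorem exists_isTopCompl (E : Grassmannian 𝕜 H) :
    ∃ F : Grassmannian 𝕜 H, E.space.IsTopCompl F.space :=
  have h : E.space.IsTopCompl E.spaceᗮ := Submodule.isTopCompl_orthogonal _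
  ⟨⟨E.spaceᗮ, h.symm.closedComplemented,
    mt (Submodule.orthogonal_eq_bot_iff (K := E.space)).1 E.2.2.2,
    mt (Submodule.orthogonal_eq_top_iff (K := E.space)).1 E.2.2.1⟩, h⟩

/-- The extension of the chart `slope E F` from the orthogonal projections onto complements of `F`
to all operators `Y` for which `Y - proj F` is invertible. -/
noncomputable def slopeExtension {E F : Grassmannian 𝕜 H} (h : E.space.IsTopCompl F.space)
    (Y : H →L[𝕜] H) : E.space →L[𝕜] F.space :=
  F.space.projectionOntoL E.space h.symm ∘L (Y * (Y - proj F)⁻¹ʳ) ∘L E.space.subtypeL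

theorem slope_eq_slopeExtension_proj {E F G : Grassmannian 𝕜 H} (h : E.space.IsTopCompl F.space)
    (hG : G.space.IsTopCompl F.space) : slope E F G = slopeExtension h (proj G) := by
  rw [slope_eq h hG, projectionL_eq_mul_inverse hG, slopeExtension, proj, proj]

theorem analyticOnNhd_slopeExtension {E F : Grassmannian 𝕜 H} (h : E.space.IsTopCompl F.space) :
    AnalyticOnNhd 𝕜 (slopeExtension h) {Y | IsUnit (Y - proj F)} := fun _ hY =>
  ((ContinuousLinearMap.compL 𝕜 E.space H F.space
    (F.space.projectionOntoL E.space h.symm) ∘L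
      (ContinuousLinearMap.compL 𝕜 E.space H H).flip E.space.subtypeL).analyticAt _).fun_comp
    (analyticAt_id.mul (analyticAt_ringInverse_comp (analyticAt_id.sub analyticAt_const) hY))

end Hilbert

variable {H : Type u} [NormedAddCommGroup H] [InnerProductSpace ℂ H] [CompleteSpace H]

theorem analyticOnNhd_proj_graph {E F : Grassmannian ℂ H} (h : E.space.IsTopCompl F.space) :
    AnalyticOnNhd ℝ (proj ∘ graph h) univ := by
  have horth : proj ∘ graph h = orthogonalize ∘
      fun S => (graph h S).space.projectionL F.space (isTopCompl_graph h S) :=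
    funext fun S =>
      (orthogonalize_projectionL (E := (graph h S).space) (isTopCompl_graph h S)).symm
  have hreal : AnalyticOnNhd ℝ (fun S =>
      (graph h S).space.projectionL F.space (isTopCompl_graph h S)) univ :=
    fun S hS => (analyticOnNhd_projectionL_graph h S hS).restrictScalars
  rw [horth]
  exact analyticOnNhd_orthogonalize.comp hreal fun S _ =>
    isUnit_projectionL_add_star_sub_one (E := (graph h S).space) (isTopCompl_graph h S)

theorem continuous_proj : Continuous (proj : Grassmannian ℂ H → H →L[ℂ] H) :=
  continuous_iSup_dom.2 fun _ => continuous_iSup_dom.2 fun _ => continuous_iSup_dom.2 fun h =>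
    continuous_coinduced_dom.2 (continuousOn_univ.1 (analyticOnNhd_proj_graph h).continuousOn)

instance : T2Space (Grassmannian ℂ H) :=
  T2Space.of_injective_continuous proj_injective continuous_proj

theorem isEmbeddedAtlas_proj :
    IsEmbeddedAtlas (proj : Grassmannian ℂ H → H →L[ℂ] H) (BanachChart.toReal '' atlas ℂ H) where
  continuous := continuous_proj
  cover E := by
    obtain ⟨F, h⟩ := exists_isTopCompl E
    exact ⟨_, mem_image_of_mem _ ⟨E, F, h, rfl⟩, h⟩
  isOpen_target := by
    rintro _ ⟨_, ⟨E, F, h, rfl⟩, rfl⟩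
    exact isOpen_univ
  continuousOn_symm := by
    rintro _ ⟨_, ⟨E, F, h, rfl⟩, rfl⟩
    exact (continuous_graph h).continuousOn
  analyticOnNhd_symm := by
    rintro _ ⟨_, ⟨E, F, h, rfl⟩, rfl⟩
    exact analyticOnNhd_proj_graph h
  exists_extension := by
    rintro _ ⟨_, ⟨E, F, h, rfl⟩, rfl⟩
    have hreal : AnalyticOnNhd ℝ (slopeExtension h) {Y | IsUnit (Y - proj F)} :=
      fun Y hY => (analyticOnNhd_slopeExtension h Y hY).restrictScalars
    exact ⟨_, _, Units.isOpen.preimage (continuous_sub_right (proj F)), hreal,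
      ext fun G => isTopCompl_iff, fun G hG => slope_eq_slopeExtension_proj h (isTopCompl_iff.2 hG)⟩

end Grassmannian

/-! ### The fibers -/

/-- The set of all idempotents with range `E`. -/
abbrev RangeFiber {𝕜 : Type} [NontriviallyNormedField 𝕜] {X : Type u} [NormedAddCommGroup X]
    [NormedSpace 𝕜 X] (E : Grassmannian 𝕜 X) : Type u :=
  Fiber (rangeMap (𝕜 := 𝕜) (X := X)) E

theorem Fiber.map_val {T B : Type u} {κ : T → B} {ω : B} (x : Fiber κ ω) : κ x.val = ω := x.2

namespace RangeFiber

open Grassmannian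

variable {𝕜 : Type} [RCLike 𝕜] {H : Type u} [NormedAddCommGroup H] [InnerProductSpace 𝕜 H]
  [CompleteSpace H] {E F G : Grassmannian 𝕜 H}

theorem proj_mul_val (x : RangeFiber E) : proj E * x.val.1 = x.val.1 := by
  obtain ⟨Q, rfl⟩ := x
  exact starProjection_mul_of_forall_mem (E := (rangeMap Q).space) fun y => ⟨y, rfl⟩

theorem val_mul_proj (x : RangeFiber E) : x.val.1 * proj E = proj E := by
  obtain ⟨Q, rfl⟩ := x
  refine (mul_starProjection_of_forall_mem (E := (rangeMap Q).space) (B := 1) ?_).trans (one_mul _)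
  rintro _ ⟨y, rfl⟩
  exact DFunLike.congr_fun Q.2.2.2 y

/-- The element of the fiber over `E` given by an operator `Q` with `P Q = Q` and `Q P = P`, where
`P` is the orthogonal projection onto `E`. -/
def ofMul {Q : H →L[𝕜] H} (hPQ : proj E * Q = Q) (hQP : Q * proj E = proj E) : RangeFiber E :=
  have hrange : Q.range = E.space := by
    ext x
    refine ⟨?_, fun hx => ⟨x, ?_⟩⟩
    · rintro ⟨y, rfl⟩
      exact mem_space_iff.2 (DFunLike.congr_fun hPQ y)
    · have hx' := DFunLike.congr_fun hQP x
      rwa [mul_apply_eq_comp, mem_space_iff.1 hx] at hx'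
  have hQ : IsIdempotentElem Q := calc
    Q * Q = Q * (proj E * Q) := by rw [hPQ]
    _ = Q := by rw [← mul_assoc, hQP, hPQ]
  ⟨⟨Q, fun h0 => E.2.2.1 (hrange.symm.trans (h0 ▸ LinearMap.range_zero)),
    fun h1 => E.2.2.2 (hrange.symm.trans (h1 ▸ LinearMap.range_id)), hQ⟩, Subtype.ext hrange⟩

/-- The direction of the affine space of all idempotents with range `E`: it consists of the
operators that vanish on `E` and have their range in `E`. -/
def direction (E : Grassmannian 𝕜 H) : Submodule 𝕜 (H →L[𝕜] H) where
  carrier := {S | proj E * S = S ∧ S * proj E = 0}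
  add_mem' h h' := ⟨by rw [mul_add, h.1, h'.1], by rw [add_mul, h.2, h'.2, add_zero]⟩
  zero_mem' := ⟨mul_zero _, zero_mul _⟩
  smul_mem' c S h := ⟨by rw [mul_smul_comm, h.1], by rw [smul_mul_assoc, h.2, smul_zero]⟩

theorem isClosed_direction (E : Grassmannian 𝕜 H) : IsClosed (direction E : Set (H →L[𝕜] H)) :=
  (isClosed_eq (continuous_const_mul (proj E)) continuous_id).inter
    (isClosed_eq (continuous_mul_const (proj E)) continuous_const)

/-- The translation by the orthogonal projection, from a fiber to its direction. All structure on a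
fiber is transported along it. -/
noncomputable def equivDirection (E : Grassmannian 𝕜 H) : RangeFiber E ≃ direction E where
  toFun x := ⟨x.val.1 - proj E,
    by rw [mul_sub, x.proj_mul_val, (isIdempotentElem_proj E).eq],
    by rw [sub_mul, x.val_mul_proj, (isIdempotentElem_proj E).eq, sub_self]⟩
  invFun S := ofMul (Q := proj E + S.1)
    (by rw [mul_add, (isIdempotentElem_proj E).eq, S.2.1])
    (by rw [add_mul, (isIdempotentElem_proj E).eq, S.2.2, add_zero])
  left_inv x := Subtype.ext (Subtype.ext (add_sub_cancel _ _))
  right_inv S := Subtype.ext (add_sub_cancel_left _ _)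

/-- The norm of a fiber: the distance to the orthogonal projection, which is the zero element. -/
@[reducible]
noncomputable def normedAddCommGroup (E : Grassmannian 𝕜 H) : NormedAddCommGroup (RangeFiber E) :=
  (equivDirection E).normedAddCommGroup

attribute [local instance] normedAddCommGroup

/-- The normed space structure of a fiber, with the orthogonal projection as its origin. -/
@[reducible]
noncomputable def normedSpace (E : Grassmannian 𝕜 H) : NormedSpace 𝕜 (RangeFiber E) :=
  (equivDirection E).normedSpace 𝕜

attribute [local instance] normedSpace

/-- `equivDirection` as a linear isometry. -/
noncomputable def isometryDirection (E : Grassmannian 𝕜 H) : RangeFiber E ≃ₗᵢ[𝕜] direction E where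
  toLinearEquiv := (equivDirection E).linearEquiv 𝕜
  norm_map' _ := rfl

theorem completeSpace (E : Grassmannian 𝕜 H) : CompleteSpace (RangeFiber E) :=
  have : CompleteSpace (direction E) := (isClosed_direction E).completeSpace_coe
  (isometryDirection E).toIsometryEquiv.completeSpace

attribute [local instance] completeSpace

/-- The linear part of the affine inclusion of a fiber into the space of operators. -/
noncomputable def incl (E : Grassmannian 𝕜 H) : RangeFiber E →ₗᵢ[𝕜] (H →L[𝕜] H) :=
  (direction E).subtypeₗᵢ.comp (isometryDirection E).toLinearIsometry

theorem incl_apply (x : RangeFiber E) : incl E x = x.val.1 - proj E := rfl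

theorem proj_mul_incl (x : RangeFiber E) : proj E * incl E x = incl E x :=
  (isometryDirection E x).2.1

theorem incl_mul_proj (x : RangeFiber E) : incl E x * proj E = 0 :=
  (isometryDirection E x).2.2

theorem proj_add_incl (x : RangeFiber E) : proj E + incl E x = x.val.1 := by
  rw [incl_apply, add_sub_cancel]

theorem val_zero (E : Grassmannian 𝕜 H) : (0 : RangeFiber E).val.1 = proj E := by
  rw [← proj_add_incl, map_zero, add_zero]

/-- The inclusion of a fiber into the space of operators, as an affine isometry. -/
noncomputable def affineIsometry (E : Grassmannian 𝕜 H) : RangeFiber E →ᵃⁱ[𝕜] (H →L[𝕜] H) :=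
  (AffineIsometryEquiv.constVAdd 𝕜 (H →L[𝕜] H) (proj E)).toAffineIsometry.comp
    (incl E).toAffineIsometry

theorem affineIsometry_apply (x : RangeFiber E) : affineIsometry E x = x.val.1 :=
  proj_add_incl x

theorem isInducing_val (E : Grassmannian 𝕜 H) :
    IsInducing (Fiber.val : RangeFiber E → idempotents 𝕜 H) := by
  have hval : Subtype.val ∘ (Fiber.val : RangeFiber E → idempotents 𝕜 H) = affineIsometry E :=
    funext fun x => (affineIsometry_apply x).symm
  rw [← IsInducing.subtypeVal.of_comp_iff, hval]
  exact (affineIsometry E).isometry.isUniformInducing.isInducing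

theorem mulLeftRight_mem_direction (E : Grassmannian 𝕜 H) (Y : H →L[𝕜] H) :
    ContinuousLinearMap.mulLeftRight 𝕜 (H →L[𝕜] H) (proj E) (1 - proj E) Y ∈ direction E :=
  ⟨by rw [ContinuousLinearMap.mulLeftRight_apply, ← mul_assoc, ← mul_assoc,
      (isIdempotentElem_proj E).eq],
    by rw [ContinuousLinearMap.mulLeftRight_apply, mul_assoc,
      (isIdempotentElem_proj E).one_sub_mul_self, mul_zero]⟩

/-- The compression `Y ↦ P Y (1 - P)` of operators to the direction of the fiber over `E`, where
`P` is the orthogonal projection onto `E`. It is a left inverse of `incl E`. -/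
noncomputable def compress (E : Grassmannian 𝕜 H) : (H →L[𝕜] H) →L[𝕜] RangeFiber E :=
  (isometryDirection E).symm.toContinuousLinearEquiv.toContinuousLinearMap ∘L
    (ContinuousLinearMap.mulLeftRight 𝕜 (H →L[𝕜] H) (proj E) (1 - proj E)).codRestrict
      (direction E) (mulLeftRight_mem_direction E)

theorem incl_compress (E : Grassmannian 𝕜 H) (Y : H →L[𝕜] H) :
    incl E (compress E Y) = proj E * Y * (1 - proj E) :=
  congrArg Subtype.val
    ((isometryDirection E).apply_symm_apply ⟨_, mulLeftRight_mem_direction E Y⟩)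

/-- The operator `S ↦ A S B` between the directions of two fibers, compressed to the second one, as
a bilinear map in `A` and `B`. -/
noncomputable def conj (E F : Grassmannian 𝕜 H) :
    (H →L[𝕜] H) →L[𝕜] (H →L[𝕜] H) →L[𝕜] (RangeFiber E →L[𝕜] RangeFiber F) :=
  ContinuousLinearMap.compL 𝕜 (H →L[𝕜] H) ((H →L[𝕜] H) →L[𝕜] (H →L[𝕜] H))
      (RangeFiber E →L[𝕜] RangeFiber F)
      (ContinuousLinearMap.compL 𝕜 (RangeFiber E) (H →L[𝕜] H) (RangeFiber F) (compress F) ∘L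
        (ContinuousLinearMap.compL 𝕜 (RangeFiber E) (H →L[𝕜] H) (H →L[𝕜] H)).flip
          (incl E).toContinuousLinearMap) ∘L
    ContinuousLinearMap.mulLeftRight 𝕜 (H →L[𝕜] H)

theorem conj_apply (A B : H →L[𝕜] H) (x : RangeFiber E) :
    conj E F A B x = compress F (A * incl E x * B) := rfl

theorem incl_conj {A B : H →L[𝕜] H} (hA : proj F * A = A * proj E) (hB : B * proj F = proj E * B)
    (x : RangeFiber E) : incl F (conj E F A B x) = A * incl E x * B := by
  have hleft : proj F * (A * incl E x * B) = A * incl E x * B := by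
    rw [← mul_assoc, ← mul_assoc, hA, mul_assoc A, proj_mul_incl]
  have hright : A * incl E x * B * proj F = 0 := by
    rw [mul_assoc, hB, ← mul_assoc, mul_assoc A, incl_mul_proj, mul_zero, zero_mul]
  rw [conj_apply, incl_compress, hleft, mul_sub, mul_one, hright, sub_zero]

theorem conj_conj {A B A' B' : H →L[𝕜] H} (hA : proj F * A = A * proj E)
    (hB : B * proj F = proj E * B) (x : RangeFiber E) :
    conj F G A' B' (conj E F A B x) = conj E G (A' * A) (B * B') x := by
  rw [conj_apply, incl_conj hA hB, conj_apply]
  simp only [mul_assoc]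

theorem conj_one_one (x : RangeFiber E) : conj E E 1 1 x = x := by
  apply (incl E).injective
  rw [incl_conj ((mul_one _).trans (one_mul _).symm) ((one_mul _).trans (mul_one _).symm), one_mul,
    mul_one]

theorem val_conj {A B : H →L[𝕜] H} (hAB : A * B = 1) (hA : proj F * A = A * proj E)
    (hB : B * proj F = proj E * B) (x : RangeFiber E) :
    (conj E F A B x).val.1 = A * (proj E + incl E x) * B := by
  rw [← proj_add_incl, incl_conj hA hB, mul_add, add_mul, ← hA, mul_assoc (proj F), hAB, mul_one]

end RangeFiber

/-! ### Local triviality -/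

section Intertwiner

variable {R : Type*} [Ring R]

/-- For idempotents `p` and `q`, this element intertwines `p` and `q`: as an operator, it maps the
range and the kernel of `p` to the range and the kernel of `q`. -/
def intertwiner (p q : R) : R := q * p + (1 - q) * (1 - p)

theorem intertwiner_self {p : R} (hp : IsIdempotentElem p) : intertwiner p p = 1 := by
  rw [intertwiner, hp.eq, hp.one_sub.eq, add_sub_cancel]

theorem mul_intertwiner {p q : R} (hp : IsIdempotentElem p) (hq : IsIdempotentElem q) :
    q * intertwiner p q = intertwiner p q * p := calc
  q * intertwiner p q = q * p := by
    rw [intertwiner, mul_add, ← mul_assoc, hq.eq, ← mul_assoc, hq.mul_one_sub_self, zero_mul,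
      add_zero]
  _ = intertwiner p q * p := by
    rw [intertwiner, add_mul, mul_assoc, hp.eq, mul_assoc, hp.one_sub_mul_self, mul_zero, add_zero]

theorem inverse_intertwiner_mul {p q : R} (hp : IsIdempotentElem p) (hq : IsIdempotentElem q)
    (hu : IsUnit (intertwiner p q)) :
    (intertwiner p q)⁻¹ʳ * q = p * (intertwiner p q)⁻¹ʳ := by
  rw [Ring.eq_mul_inverse_iff_mul_eq _ _ _ hu, mul_assoc, mul_intertwiner hp hq, ← mul_assoc,
    Ring.inverse_mul_cancel _ hu, one_mul]

theorem analyticAt_intertwiner {𝕜 A : Type*} [NontriviallyNormedField 𝕜] [NormedRing A]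
    [NormedAlgebra 𝕜 A] (p q : A) : AnalyticAt 𝕜 (intertwiner p) q := by
  unfold intertwiner
  fun_prop

end Intertwiner

namespace RangeFiber

open Grassmannian

attribute [local instance] normedAddCommGroup normedSpace completeSpace

section Transport

variable {𝕜 : Type} [RCLike 𝕜] {H : Type u} [NormedAddCommGroup H] [InnerProductSpace 𝕜 H]
  [CompleteSpace H] {E F : Grassmannian 𝕜 H}

/-- The neighborhood of `E` over which the bundle of idempotents is trivialized. -/
def trivializationSet (E : Grassmannian 𝕜 H) : Set (Grassmannian 𝕜 H) :=
  {F | IsUnit (intertwiner (proj E) (proj F))}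

theorem mem_trivializationSet_self (E : Grassmannian 𝕜 H) : E ∈ trivializationSet E := by
  rw [trivializationSet, mem_ofPred_eq, intertwiner_self (isIdempotentElem_proj E)]
  exact isUnit_one

theorem proj_mul_intertwiner (E F : Grassmannian 𝕜 H) :
    proj F * intertwiner (proj E) (proj F) = intertwiner (proj E) (proj F) * proj E :=
  mul_intertwiner (isIdempotentElem_proj E) (isIdempotentElem_proj F)

theorem inverse_intertwiner_mul_proj (hF : F ∈ trivializationSet E) :
    (intertwiner (proj E) (proj F))⁻¹ʳ * proj F = proj E * (intertwiner (proj E) (proj F))⁻¹ʳ :=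
  inverse_intertwiner_mul (isIdempotentElem_proj E) (isIdempotentElem_proj F) hF

/-- The operator between the fibers over `E` and `F` that conjugates by the intertwiner of the
orthogonal projections. It is an isomorphism for `F ∈ trivializationSet E`. -/
noncomputable def transport (E F : Grassmannian 𝕜 H) : RangeFiber E →L[𝕜] RangeFiber F :=
  conj E F (intertwiner (proj E) (proj F)) (intertwiner (proj E) (proj F))⁻¹ʳ

/-- The inverse of `transport E F`, for `F ∈ trivializationSet E`. -/
noncomputable def transportInv (E F : Grassmannian 𝕜 H) : RangeFiber F →L[𝕜] RangeFiber E :=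
  conj F E (intertwiner (proj E) (proj F))⁻¹ʳ (intertwiner (proj E) (proj F))

theorem transportInv_transport (hF : F ∈ trivializationSet E) (x : RangeFiber E) :
    transportInv E F (transport E F x) = x := by
  rw [transportInv, transport, conj_conj (proj_mul_intertwiner E F)
    (inverse_intertwiner_mul_proj hF), Ring.inverse_mul_cancel _ hF, conj_one_one]

theorem transport_transportInv (hF : F ∈ trivializationSet E) (x : RangeFiber F) :
    transport E F (transportInv E F x) = x := by
  rw [transportInv, transport, conj_conj (inverse_intertwiner_mul_proj hF).symm
    (proj_mul_intertwiner E F).symm, Ring.mul_inverse_cancel _ hF, conj_one_one]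

/-- The fiber coordinate of an idempotent in the trivialization at `E`. -/
noncomputable def fiberCoord (E : Grassmannian 𝕜 H) (Q : idempotents 𝕜 H) : RangeFiber E :=
  transportInv E (rangeMap Q) ⟨Q, rfl⟩

theorem fiberCoord_val (E : Grassmannian 𝕜 H) (y : RangeFiber F) :
    fiberCoord E y.val = transportInv E F y := by
  obtain ⟨Q, rfl⟩ := y
  rfl

/-- The trivialization of the bundle of idempotents over `trivializationSet E`. -/
noncomputable def trivialization (E : Grassmannian 𝕜 H) :
    PartialEquiv (Grassmannian 𝕜 H × RangeFiber E) (idempotents 𝕜 H) where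
  toFun p := (transport E p.1 p.2).val
  invFun Q := (rangeMap Q, fiberCoord E Q)
  source := trivializationSet E ×ˢ univ
  target := rangeMap ⁻¹' trivializationSet E
  map_source' p hp := by
    rw [mem_preimage, (transport E p.1 p.2).map_val]
    exact hp.1
  map_target' Q hQ := ⟨hQ, mem_univ _⟩
  left_inv' p hp := by
    rw [(transport E p.1 p.2).map_val, fiberCoord_val, transportInv_transport hp.1]
  right_inv' Q hQ := congrArg Fiber.val (transport_transportInv hQ ⟨Q, rfl⟩)

theorem rangeMap_surjective : Function.Surjective (rangeMap (𝕜 := 𝕜) (X := H)) :=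
  fun E => ⟨(0 : RangeFiber E).val, Fiber.map_val _⟩

end Transport

section Analytic

variable {H : Type u} [NormedAddCommGroup H] [InnerProductSpace ℂ H] [CompleteSpace H]

theorem isOpen_trivializationSet (E : Grassmannian ℂ H) : IsOpen (trivializationSet E) :=
  have hcont : Continuous (intertwiner (proj E)) := continuous_iff_continuousAt.2 fun Y =>
    (analyticAt_intertwiner (𝕜 := ℂ) (proj E) Y).continuousAt
  Units.isOpen.preimage (hcont.comp continuous_proj)

theorem isAnalyticMapOn_rangeMap :
    IsAnalyticMapOn (BanachChart.toReal '' submanifoldAtlas ℂ (idempotents ℂ H))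
      (BanachChart.toReal '' atlas ℂ H) (rangeMap (𝕜 := ℂ) (X := H)) univ :=
  (isEmbeddedAtlas_idempotents ℂ H).toReal.isAnalyticMapOn isEmbeddedAtlas_proj isOpen_univ
    analyticOnNhd_orthogonalize (fun Q _ => isUnit_add_star_sub_one Q.2.2.2)
    fun Q _ => proj_rangeMap Q

theorem isAnalyticMapOn_trivialization (E : Grassmannian ℂ H) :
    IsAnalyticMapOn (prodAtlas (BanachChart.toReal '' atlas ℂ H) (modelAtlas ℝ (RangeFiber E)))
      (BanachChart.toReal '' submanifoldAtlas ℂ (idempotents ℂ H)) (trivialization E)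
      (trivializationSet E ×ˢ univ) := by
  refine (isEmbeddedAtlas_proj.prod (IsEmbeddedAtlas.modelAtlas _)).isAnalyticMapOn
    (isEmbeddedAtlas_idempotents ℂ H).toReal ((isOpen_trivializationSet E).prod isOpen_univ)
    (G := fun p => intertwiner (proj E) p.1 * (proj E + incl E p.2) *
      (intertwiner (proj E) p.1)⁻¹ʳ)
    (O := {Y | IsUnit (intertwiner (proj E) Y)} ×ˢ univ) ?_ (fun p hp => hp) ?_
  · intro p hp
    have hu := (analyticAt_intertwiner (𝕜 := ℝ) (proj E) p.1).fun_comp (analyticAt_fst (p := p))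
    have hincl : AnalyticAt ℝ (incl E) p.2 :=
      ((incl E).toContinuousLinearMap.analyticAt p.2).restrictScalars
    exact (hu.mul (analyticAt_const.add (hincl.fun_comp analyticAt_snd))).mul
      (analyticAt_ringInverse_comp hu hp.1)
  · rintro ⟨F, x⟩ hF
    exact val_conj (Ring.mul_inverse_cancel _ hF.1) (proj_mul_intertwiner E F)
      (inverse_intertwiner_mul_proj hF.1) x

theorem isAnalyticMapOn_trivialization_symm (E : Grassmannian ℂ H) :
    IsAnalyticMapOn (BanachChart.toReal '' submanifoldAtlas ℂ (idempotents ℂ H))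
      (prodAtlas (BanachChart.toReal '' atlas ℂ H) (modelAtlas ℝ (RangeFiber E)))
      (trivialization E).symm (rangeMap ⁻¹' trivializationSet E) := by
  refine (isEmbeddedAtlas_idempotents ℂ H).toReal.isAnalyticMapOn
    (isEmbeddedAtlas_proj.prod (IsEmbeddedAtlas.modelAtlas _))
    ((isOpen_trivializationSet E).preimage
      (continuousOn_univ.1 isAnalyticMapOn_rangeMap.continuousOn))
    (G := fun Q => (orthogonalize Q, compress E
      ((intertwiner (proj E) (orthogonalize Q))⁻¹ʳ * (Q - orthogonalize Q) *
        intertwiner (proj E) (orthogonalize Q))))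
    (O := {Q | IsUnit (Q + star Q - 1) ∧ IsUnit (intertwiner (proj E) (orthogonalize Q))})
    ?_ (fun Q hQ => ⟨isUnit_add_star_sub_one Q.2.2.2, proj_rangeMap Q ▸ hQ⟩) fun Q _ => ?_
  · rintro Q ⟨hQ, hu⟩
    have horth := analyticOnNhd_orthogonalize Q hQ
    have hinter := (analyticAt_intertwiner (𝕜 := ℝ) (proj E) _).fun_comp horth
    have hcompress (Y : H →L[ℂ] H) : AnalyticAt ℝ (compress E) Y :=
      ((compress E).analyticAt Y).restrictScalars
    exact horth.prod ((hcompress _).fun_comp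
      (((analyticAt_ringInverse_comp hinter hu).mul (analyticAt_id.sub horth)).mul hinter))
  · rw [Function.comp_apply, Function.comp_apply, ← proj_rangeMap]
    rfl

theorem exists_isAnalyticMapOn_transition (E F : Grassmannian ℂ H) :
    ∃ φ : Grassmannian ℂ H → (RangeFiber E →L[ℂ] RangeFiber F),
      (∀ G ∈ trivializationSet E ∩ trivializationSet F, ∀ x,
        φ G x = ((trivialization F).symm (trivialization E (G, x))).2) ∧
      IsAnalyticMapOn (BanachChart.toReal '' atlas ℂ H)
        (modelAtlas ℝ (RangeFiber E →L[ℂ] RangeFiber F)) φ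
        (trivializationSet E ∩ trivializationSet F) := by
  let u (G : Grassmannian ℂ H) (Y : H →L[ℂ] H) : H →L[ℂ] H := intertwiner (proj G) Y
  let Φ (Y : H →L[ℂ] H) : RangeFiber E →L[ℂ] RangeFiber F :=
    conj E F ((u F Y)⁻¹ʳ * u E Y) ((u E Y)⁻¹ʳ * u F Y)
  refine ⟨Φ ∘ proj, fun G hG x => ?_, ?_⟩
  · calc Φ (proj G) x = transportInv F G (transport E G x) :=
          (conj_conj (proj_mul_intertwiner E G) (inverse_intertwiner_mul_proj hG.1) x).symm
      _ = fiberCoord F (transport E G x).val := (fiberCoord_val F _).symm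
  · refine isEmbeddedAtlas_proj.isAnalyticMapOn (IsEmbeddedAtlas.modelAtlas _)
      ((isOpen_trivializationSet E).inter (isOpen_trivializationSet F)) (G := Φ)
      (O := {Y | IsUnit (u E Y) ∧ IsUnit (u F Y)}) ?_ (fun _ h => h) fun _ _ => rfl
    rintro Y ⟨hE, hF⟩
    have hu (G : Grassmannian ℂ H) : AnalyticAt ℂ (u G) Y := analyticAt_intertwiner _ Y
    have hpair : AnalyticAt ℂ (fun Y => ((u F Y)⁻¹ʳ * u E Y, (u E Y)⁻¹ʳ * u F Y)) Y :=
      ((analyticAt_ringInverse_comp (hu F) hF).mul (hu E)).prod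
        ((analyticAt_ringInverse_comp (hu E) hE).mul (hu F))
    have hconj (p : (H →L[ℂ] H) × (H →L[ℂ] H)) : AnalyticAt ℂ (fun p => conj E F p.1 p.2) p :=
      (conj E F).analyticAt_bilinear p
    exact ((hconj _).fun_comp hpair).restrictScalars

theorem isRealAnalyticComplexBanachBundle_rangeMap :
    IsRealAnalyticComplexBanachBundle
      (BanachChart.toReal '' submanifoldAtlas ℂ (idempotents ℂ H))
      (BanachChart.toReal '' atlas ℂ H) (rangeMap (𝕜 := ℂ) (X := H)) :=
  ⟨inferInstance, inferInstance, (isEmbeddedAtlas_idempotents ℂ H).toReal.isAnalyticAtlas,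
    isEmbeddedAtlas_proj.isAnalyticAtlas, rangeMap_surjective, isAnalyticMapOn_rangeMap,
    isInducing_val, trivializationSet, trivialization,
    fun E => ⟨isOpen_trivializationSet E, mem_trivializationSet_self E, rfl, rfl,
      isAnalyticMapOn_trivialization E, isAnalyticMapOn_trivialization_symm E,
      fun F hF => ⟨(transport E F).toLinearMap,
        fun y => ⟨transportInv E F y, transport_transportInv hF y⟩, fun _ => rfl⟩⟩,
    exists_isAnalyticMapOn_transition⟩

end Analytic

end RangeFiber

/-- The last conjunct says that, for the atlas of the Banach submanifold of all idempotents and the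
atlas of the Grassmann manifold, seen as real analytic atlases, the map `rangeMap` is a
locally trivial real analytic complex Banach bundle. -/
theorem mainTheorem9 (H : Type u) [NormedAddCommGroup H] [InnerProductSpace ℂ H]
    [CompleteSpace H] :
    ∃ (_ : ∀ E : Grassmannian ℂ H, NormedAddCommGroup (Fiber (rangeMap (𝕜 := ℂ) (X := H)) E))
      (_ : ∀ E : Grassmannian ℂ H, NormedSpace ℂ (Fiber (rangeMap (𝕜 := ℂ) (X := H)) E))
      (_ : ∀ E : Grassmannian ℂ H, CompleteSpace (Fiber (rangeMap (𝕜 := ℂ) (X := H)) E)),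
      (∀ E : Grassmannian ℂ H,
        ((0 : Fiber (rangeMap (𝕜 := ℂ) (X := H)) E).val : H →L[ℂ] H) =
          E.space.starProjection) ∧
      (∀ E : Grassmannian ℂ H,
        ∃ f : Fiber (rangeMap (𝕜 := ℂ) (X := H)) E →ᵃⁱ[ℂ] (H →L[ℂ] H),
          ∀ x, f x = (x.val : H →L[ℂ] H)) ∧
      IsRealAnalyticComplexBanachBundle
        (BanachChart.toReal '' submanifoldAtlas ℂ (idempotents ℂ H))
        (BanachChart.toReal '' Grassmannian.atlas ℂ H)
        (rangeMap (𝕜 := ℂ) (X := H)) := by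
  exact ⟨RangeFiber.normedAddCommGroup, RangeFiber.normedSpace, RangeFiber.completeSpace,
    RangeFiber.val_zero, fun E => ⟨RangeFiber.affineIsometry E, RangeFiber.affineIsometry_apply⟩,
    RangeFiber.isRealAnalyticComplexBanachBundle_rangeMap⟩
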